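/- Let $S,T$ be semigroups and let $\psi:S\to T$ be a surjective semigroup homomorphism. A weight on a semigroup $S$ is a function $\omega:S\to(0,\infty)$ with $\omega(st)\le\omega(s)\omega(t)$ for all $s,t\in S$. Write $\Omega(s,t)=\frac{\omega(st)}{\omega(s)\omega(t)}$, and let $\ell_1(S,\omega)$ be the algebra of all $g:S\to\mathbb C$ with $\|g\|=\sum_{s\in S}|g(s)|\,\omega(s)<\infty$, with this norm and the convolution product $(f*g)(u)=\sum_{st=u}f(s)g(t)$. A Banach algebra is (Arens) regular if the two Arens products on its second dual coincide. $\Omega$ is $0$-cluster if for all sequences $(x_n)$, $(y_m)$ of distinct elements of $S$ for which both iterated limits $\lim_n\lim_m\Omega(x_n,y_m)$ and $\lim_m\lim_n\Omega(x_n,y_m)$ exist, both are equal to $0$. (i) Let $\omega$ be a weight on $S$ with $\inf\omega(S)>0$, and let $\overrightarrow{\omega}$ be the weight on $T$ given by $\overrightarrow{\omega}(t)=\inf\omega(\psi^{-1}(t))$, with associated function $\overrightarrow{\Omega}(t,u)=\frac{\overrightarrow{\omega}(tu)}{\overrightarrow{\omega}(t)\overrightarrow{\omega}(u)}$. If $\ell_1(S,\omega)$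 is regular, then $\ell_1(T,\overrightarrow{\omega})$ is regular. Furthermore, if $\Omega$ is $0$-cluster, then $\overrightarrow{\Omega}$ is $0$-cluster. (ii) Let $\omega$ be a weight on $T$. If $\ell_1(S,\omega\circ\psi)$ is regular, then $\ell_1(T,\omega)$ is regular. -/

import Mathlib

/-!
# Weighted semigroup algebras, Arens regularity and 0-cluster weights
-/

open Filter Topology

set_option maxSynthPendingDepth 3

noncomputable section

namespace ArensReg

/-! ### Arens products and Arens regularity of a normed algebra -/

section Arens

/-- The Arens adjoint of a bounded bilinear map `m : X × Y → Z`: the bounded bilinear map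
`m* : Z* × X → Y*` given by `⟨m*(f, x), y⟩ = ⟨f, m(x, y)⟩`. -/
def arensAdjoint {X Y Z : Type*}
    [NormedAddCommGroup X] [NormedSpace ℂ X] [NormedAddCommGroup Y] [NormedSpace ℂ Y]
    [NormedAddCommGroup Z] [NormedSpace ℂ Z] (m : X →L[ℂ] Y →L[ℂ] Z) :
    StrongDual ℂ Z →L[ℂ] X →L[ℂ] StrongDual ℂ Y :=
  ((ContinuousLinearMap.compL ℂ X (Y →L[ℂ] Z) (StrongDual ℂ Y)).flip m).comp
    (ContinuousLinearMap.compL ℂ Y Z ℂ)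

theorem arensAdjoint_apply {X Y Z : Type*}
    [NormedAddCommGroup X] [NormedSpace ℂ X] [NormedAddCommGroup Y] [NormedSpace ℂ Y]
    [NormedAddCommGroup Z] [NormedSpace ℂ Z] (m : X →L[ℂ] Y →L[ℂ] Z)
    (f : StrongDual ℂ Z) (x : X) (y : Y) : arensAdjoint m f x y = f (m x y) := rfl

variable (A : Type*) [NonUnitalNormedRing A] [NormedSpace ℂ A] [IsScalarTower ℂ A A]
  [SMulCommClass ℂ A A]

/-- The first Arens product `□` on `A**`: `⟨f·a, b⟩ = ⟨f, ab⟩`, `⟨Ψ·f, a⟩ = ⟨Ψ, f·a⟩`,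
`⟨Φ □ Ψ, f⟩ = ⟨Φ, Ψ·f⟩`. -/
def firstArens : StrongDual ℂ (StrongDual ℂ A) →L[ℂ] StrongDual ℂ (StrongDual ℂ A) →L[ℂ]
    StrongDual ℂ (StrongDual ℂ A) :=
  arensAdjoint (arensAdjoint (arensAdjoint (ContinuousLinearMap.mul ℂ A)))

/-- The second Arens product `◇` on `A**`: `⟨a·f, b⟩ = ⟨f, ba⟩`, `⟨f·Φ, a⟩ = ⟨Φ, a·f⟩`,
`⟨Φ ◇ Ψ, f⟩ = ⟨Ψ, f·Φ⟩`. -/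
def secondArens : StrongDual ℂ (StrongDual ℂ A) →L[ℂ] StrongDual ℂ (StrongDual ℂ A) →L[ℂ]
    StrongDual ℂ (StrongDual ℂ A) :=
  (arensAdjoint (arensAdjoint (arensAdjoint (ContinuousLinearMap.mul ℂ A).flip))).flip

/-- `A` is Arens regular if the two Arens products on `A**` coincide. -/
def IsArensRegular : Prop :=
  ∀ Φ Ψ : StrongDual ℂ (StrongDual ℂ A), firstArens A Φ Ψ = secondArens A Φ Ψ

end Arens

/-! ### Weights -/

/-- A weight on a semigroup: a function `ω : S → (0, ∞)` with `ω(st) ≤ ω(s) ω(t)`. -/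
structure Weight (S : Type*) [Semigroup S] where
  /-- the underlying function -/
  toFun : S → ℝ
  pos' : ∀ s, 0 < toFun s
  mul_le' : ∀ s t, toFun (s * t) ≤ toFun s * toFun t

namespace Weight

variable {S T : Type*} [Semigroup S] [Semigroup T]

instance : CoeFun (Weight S) (fun _ => S → ℝ) := ⟨Weight.toFun⟩

theorem pos (ω : Weight S) (s : S) : 0 < ω s := ω.pos' s

theorem mul_le (ω : Weight S) (s t : S) : ω (s * t) ≤ ω s * ω t := ω.mul_le' s t

/-- `Ω(s, t) = ω(st) / (ω(s) ω(t))`. -/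
def Omega (ω : Weight S) (s t : S) : ℝ := ω (s * t) / (ω s * ω t)

/-- `Ω` is 0-cluster: for all sequences `(x_n)`, `(y_m)` of distinct elements of `S`, if both
iterated limits of `Ω(x_n, y_m)` exist, then both of them are `0`. -/
def IsZeroCluster (ω : Weight S) : Prop :=
  ∀ x y : ℕ → S, Function.Injective x → Function.Injective y →
    ∀ (f g : ℕ → ℝ) (a b : ℝ),
      (∀ n, Tendsto (fun m => ω.Omega (x n) (y m)) atTop (𝓝 (f n))) →
      Tendsto f atTop (𝓝 a) →
      (∀ m, Tendsto (fun n => ω.Omega (x n) (y m)) atTop (𝓝 (g m))) →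
      Tendsto g atTop (𝓝 b) →
      a = 0 ∧ b = 0

/-- `ω` is bounded below by a positive constant. -/
def IsBoundedBelow (ω : Weight S) : Prop := ∃ ε : ℝ, 0 < ε ∧ ∀ s, ε ≤ ω s

/-- The weight `ω ∘ ψ` on `S`, for a weight `ω` on `T`. -/
def comap (ψ : S →ₙ* T) (ω : Weight T) : Weight S where
  toFun s := ω (ψ s)
  pos' s := ω.pos (ψ s)
  mul_le' s t := by rw [map_mul]; exact ω.mul_le _ _

/-- The weight `t ↦ inf ω(ψ⁻¹(t))` on `T`, for an epimorphism `ψ : S → T` and a weight `ω` on `S`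
that is bounded below. -/
def push (ψ : S →ₙ* T) (hψ : Function.Surjective ψ) (ω : Weight S) (hω : ω.IsBoundedBelow) :
    Weight T where
  toFun t := sInf (ω '' (ψ ⁻¹' {t}))
  pos' t := by
    obtain ⟨ε, hε, h⟩ := hω
    obtain ⟨s, hs⟩ := hψ t
    refine hε.trans_le (le_csInf ⟨ω s, s, hs, rfl⟩ ?_)
    rintro _ ⟨r, -, rfl⟩
    exact h r
  mul_le' t u := by
    have bdd : ∀ v, BddBelow (ω '' (ψ ⁻¹' {v})) := fun v =>
      ⟨0, by rintro _ ⟨r, -, rfl⟩; exact (ω.pos r).le⟩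
    have ne : ∀ v, (ω '' (ψ ⁻¹' {v})).Nonempty := fun v =>
      let ⟨s, hs⟩ := hψ v
      ⟨ω s, s, hs, rfl⟩
    have nn : ∀ v, 0 ≤ sInf (ω '' (ψ ⁻¹' {v})) := fun v =>
      le_csInf (ne v) (by rintro _ ⟨r, -, rfl⟩; exact (ω.pos r).le)
    refine le_of_forall_pos_lt_add fun δ hδ => ?_
    have hc : Tendsto (fun e : ℝ => (sInf (ω '' (ψ ⁻¹' {t})) + e) *
        (sInf (ω '' (ψ ⁻¹' {u})) + e)) (𝓝[>] 0)
        (𝓝 (sInf (ω '' (ψ ⁻¹' {t})) * sInf (ω '' (ψ ⁻¹' {u})))) := by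
      have : Continuous (fun e : ℝ => (sInf (ω '' (ψ ⁻¹' {t})) + e) *
        (sInf (ω '' (ψ ⁻¹' {u})) + e)) := by fun_prop
      simpa using (this.tendsto 0).mono_left nhdsWithin_le_nhds
    obtain ⟨e, he, he0⟩ := ((hc.eventually_lt_const (lt_add_of_pos_right _ hδ)).and
      self_mem_nhdsWithin).exists
    have he0 : 0 < e := he0
    obtain ⟨_, ⟨a, ha, rfl⟩, hat⟩ := exists_lt_of_csInf_lt (ne t) (lt_add_of_pos_right _ he0)
    obtain ⟨_, ⟨b, hb, rfl⟩, hbu⟩ := exists_lt_of_csInf_lt (ne u) (lt_add_of_pos_right _ he0)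
    have hab : ω (a * b) ∈ ω '' (ψ ⁻¹' {t * u}) := by
      refine ⟨a * b, ?_, rfl⟩
      simp only [Set.mem_preimage, Set.mem_singleton_iff] at ha hb ⊢
      rw [map_mul, ha, hb]
    calc sInf (ω '' (ψ ⁻¹' {t * u})) ≤ ω (a * b) := csInf_le (bdd _) hab
      _ ≤ ω a * ω b := ω.mul_le a b
      _ ≤ _ := mul_le_mul hat.le hbu.le (ω.pos b).le (by linarith [nn t])
      _ < _ := he

end Weight

/-! ### The weighted semigroup algebra `ℓ₁(S, ω)` -/

section L1

variable {S : Type*} [Semigroup S]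

/-- The functions `g : S → ℂ` with `∑ |g(s)| ω(s) < ∞`, as a linear subspace of `S → ℂ`. -/
def l1Submodule (ω : Weight S) : Submodule ℂ (S → ℂ) where
  carrier := {g | Summable fun s => ‖g s‖ * ω s}
  zero_mem' := by simp
  add_mem' {f g} hf hg := by
    refine Summable.of_nonneg_of_le (fun s => mul_nonneg (norm_nonneg _) (ω.pos s).le)
      (fun s => ?_) (Summable.add hf hg)
    rw [← add_mul]
    exact mul_le_mul_of_nonneg_right (norm_add_le _ _) (ω.pos s).le
  smul_mem' c f hf := by
    have := Summable.mul_left ‖c‖ hf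
    simpa [mul_assoc] using this

/-- The weighted semigroup algebra `ℓ₁(S, ω)`, with pointwise linear structure, the norm
`‖g‖ = ∑ |g(s)| ω(s)` and convolution as multiplication. -/
def L1 (ω : Weight S) : Type _ := l1Submodule ω

namespace L1

variable {ω : Weight S}

instance : AddCommGroup (L1 ω) := inferInstanceAs (AddCommGroup (l1Submodule ω))

instance : Module ℂ (L1 ω) := inferInstanceAs (Module ℂ (l1Submodule ω))

/-- The function `S → ℂ` underlying an element of `ℓ₁(S, ω)`. -/
def toFun (g : L1 ω) : S → ℂ := Subtype.val (p := fun x => x ∈ l1Submodule ω) g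

instance : CoeFun (L1 ω) (fun _ => S → ℂ) := ⟨toFun⟩

/-- The element of `ℓ₁(S, ω)` given by a function with `∑ |g(s)| ω(s) < ∞`. -/
def mk (g : S → ℂ) (hg : Summable fun s => ‖g s‖ * ω s) : L1 ω :=
  Subtype.mk (p := fun x => x ∈ l1Submodule ω) g hg

@[simp] theorem mk_apply (g : S → ℂ) (hg : Summable fun s => ‖g s‖ * ω s) (s : S) :
    mk g hg s = g s := rfl

@[ext]
theorem ext {f g : L1 ω} (h : ∀ s, f s = g s) : f = g := Subtype.ext (funext h)

@[simp] theorem zero_apply (s : S) : (0 : L1 ω) s = 0 := rfl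
@[simp] theorem add_apply (f g : L1 ω) (s : S) : (f + g) s = f s + g s := rfl
@[simp] theorem smul_apply (c : ℂ) (f : L1 ω) (s : S) : (c • f) s = c * f s := rfl

theorem summable (f : L1 ω) : Summable fun s => ‖f s‖ * ω s := f.2

theorem term_nonneg (f : L1 ω) (s : S) : 0 ≤ ‖f s‖ * ω s :=
  mul_nonneg (norm_nonneg _) (ω.pos s).le

instance : Norm (L1 ω) := ⟨fun g => ∑' s, ‖g s‖ * ω s⟩

theorem norm_def (g : L1 ω) : ‖g‖ = ∑' s, ‖g s‖ * ω s := rfl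

theorem normCore : NormedSpace.Core ℂ (L1 ω) where
  norm_nonneg f := tsum_nonneg f.term_nonneg
  norm_smul c f := by
    simp only [norm_def, smul_apply, norm_mul, mul_assoc]
    exact tsum_mul_left
  norm_triangle f g := by
    simp only [norm_def]
    rw [← f.summable.tsum_add g.summable]
    refine (f + g).summable.tsum_le_tsum (fun s => ?_) (f.summable.add g.summable)
    rw [← add_mul]
    exact mul_le_mul_of_nonneg_right (norm_add_le _ _) (ω.pos s).le
  norm_eq_zero_iff f := by
    constructor
    · intro h
      ext s
      have h' := f.summable.hasSum
      rw [← norm_def, h] at h'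
      have h0 := (hasSum_zero_iff_of_nonneg f.term_nonneg).1 h'
      have := congrFun h0 s
      simpa [(ω.pos s).ne'] using this
    · rintro rfl
      simp [norm_def]

instance : NormedAddCommGroup (L1 ω) := NormedAddCommGroup.ofCore normCore

instance : NormedSpace ℂ (L1 ω) := NormedSpace.ofCore normCore

/-- Convolution: `(f * g)(u) = ∑_{st = u} f(s) g(t)`. -/
def conv (f g : S → ℂ) (u : S) : ℂ := ∑' p : {p : S × S // p.1 * p.2 = u}, f p.1.1 * g p.1.2

theorem summable_prod (f g : L1 ω) :
    Summable fun p : S × S => (‖f p.1‖ * ω p.1) * (‖g p.2‖ * ω p.2) :=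
  f.summable.mul_of_nonneg g.summable f.term_nonneg g.term_nonneg

theorem prod_le (f g : L1 ω) (p : S × S) :
    ‖f p.1 * g p.2‖ * ω (p.1 * p.2) ≤ (‖f p.1‖ * ω p.1) * (‖g p.2‖ * ω p.2) := by
  rw [norm_mul, mul_mul_mul_comm]
  exact mul_le_mul_of_nonneg_left (ω.mul_le _ _) (by positivity)

theorem summable_prod' (f g : L1 ω) :
    Summable fun p : S × S => ‖f p.1 * g p.2‖ * ω (p.1 * p.2) :=
  Summable.of_nonneg_of_le (fun _ => mul_nonneg (norm_nonneg _) (ω.pos _).le)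
    (prod_le f g) (summable_prod f g)

theorem summable_sigma (f g : L1 ω) :
    Summable fun q : (Σ u : S, {p : S × S // p.1 * p.2 = u}) =>
      ‖f q.2.1.1 * g q.2.1.2‖ * ω q.1 := by
  have h := (Equiv.sigmaFiberEquiv (fun p : S × S => p.1 * p.2)).summable_iff.2
    (summable_prod' f g)
  refine h.congr ?_
  rintro ⟨u, p, rfl⟩
  rfl

theorem summable_fiber (f g : L1 ω) (u : S) :
    Summable fun p : {p : S × S // p.1 * p.2 = u} => ‖f p.1.1 * g p.1.2‖ := by
  have h := (summable_sigma f g).sigma_factor u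
  exact (summable_mul_right_iff (ω.pos u).ne').1 h

theorem norm_conv_le (f g : L1 ω) (u : S) :
    ‖conv f g u‖ * ω u ≤
      ∑' p : {p : S × S // p.1 * p.2 = u}, ‖f p.1.1 * g p.1.2‖ * ω u := by
  rw [tsum_mul_right]
  exact mul_le_mul_of_nonneg_right (norm_tsum_le_tsum_norm (summable_fiber f g u)) (ω.pos u).le

theorem summable_conv (f g : L1 ω) : Summable fun u => ‖conv f g u‖ * ω u :=
  Summable.of_nonneg_of_le (fun u => mul_nonneg (norm_nonneg _) (ω.pos u).le)
    (norm_conv_le f g) (summable_sigma f g).sigma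

instance : Mul (L1 ω) := ⟨fun f g => mk (conv f g) (summable_conv f g)⟩

theorem mul_apply (f g : L1 ω) (u : S) :
    (f * g) u = ∑' p : {p : S × S // p.1 * p.2 = u}, f p.1.1 * g p.1.2 := rfl

theorem norm_mul_le' (f g : L1 ω) : ‖f * g‖ ≤ ‖f‖ * ‖g‖ := by
  have h1 : ‖f * g‖ ≤ ∑' u, ∑' p : {p : S × S // p.1 * p.2 = u}, ‖f p.1.1 * g p.1.2‖ * ω u :=
    (summable_conv f g).tsum_le_tsum (norm_conv_le f g) (summable_sigma f g).sigma
  have h2 : ∑' u, ∑' p : {p : S × S // p.1 * p.2 = u}, ‖f p.1.1 * g p.1.2‖ * ω u =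
      ∑' p : S × S, ‖f p.1 * g p.2‖ * ω (p.1 * p.2) := by
    rw [← (summable_sigma f g).tsum_sigma,
      ← (Equiv.sigmaFiberEquiv (fun p : S × S => p.1 * p.2)).tsum_eq]
    refine tsum_congr ?_
    rintro ⟨u, p, rfl⟩
    rfl
  have h3 : ∑' p : S × S, ‖f p.1 * g p.2‖ * ω (p.1 * p.2) ≤ ‖f‖ * ‖g‖ := by
    rw [norm_def, norm_def,
      f.summable.tsum_mul_tsum g.summable (summable_prod f g)]
    exact (summable_prod' f g).tsum_le_tsum (prod_le f g) (summable_prod f g)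
  exact h1.trans (h2.le.trans h3)

/-- `∑_u φ(u) (f * g)(u) = ∑_{s,t} φ(st) f(s) g(t)` when `φ / ω` is bounded. -/
theorem tsum_mul_conv (f g : L1 ω) (φ : S → ℂ) (C : ℝ) (hφ : ∀ u, ‖φ u‖ ≤ C * ω u) :
    ∑' u, φ u * (f * g) u = ∑' p : S × S, φ (p.1 * p.2) * (f p.1 * g p.2) := by
  have hs : Summable fun q : (Σ u : S, {p : S × S // p.1 * p.2 = u}) =>
      φ q.1 * (f q.2.1.1 * g q.2.1.2) := by
    refine Summable.of_norm_bounded ((summable_sigma f g).mul_left C) fun q => ?_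
    rw [norm_mul]
    calc _ ≤ C * ω q.1 * ‖f q.2.1.1 * g q.2.1.2‖ :=
          mul_le_mul_of_nonneg_right (hφ _) (norm_nonneg _)
      _ = _ := by ring
  rw [← (Equiv.sigmaFiberEquiv (fun p : S × S => p.1 * p.2)).tsum_eq]
  have : ∑' q : (Σ u : S, {p : S × S // p.1 * p.2 = u}), φ q.1 * (f q.2.1.1 * g q.2.1.2) =
      ∑' u, φ u * (f * g) u := by
    rw [hs.tsum_sigma]
    refine tsum_congr fun u => ?_
    rw [mul_apply]
    exact (summable_fiber f g u).of_norm.tsum_mul_left (φ u)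
  rw [← this]
  refine tsum_congr ?_
  rintro ⟨u, p, rfl⟩
  rfl

open Classical in
theorem mul_apply_eq_ite (f g : L1 ω) (v : S) :
    (f * g) v = ∑' p : S × S, (if p.1 * p.2 = v then 1 else 0) * (f p.1 * g p.2) := by
  rw [mul_apply]
  have h := tsum_subtype {p : S × S | p.1 * p.2 = v} (fun p => f p.1 * g p.2)
  refine Eq.trans h (tsum_congr fun p => ?_)
  by_cases hp : p.1 * p.2 = v <;> simp [Set.indicator, hp]

open Classical in
theorem norm_ite_le (ω : Weight S) (v : S) (a : S) :
    ‖(if a = v then 1 else 0 : ℂ)‖ ≤ (ω v)⁻¹ * ω a := by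
  split_ifs with h
  · rw [h, inv_mul_cancel₀ (ω.pos v).ne']; simp
  · rw [norm_zero]; exact mul_nonneg (inv_nonneg.2 (ω.pos v).le) (ω.pos a).le

open Classical in
theorem summable_ite (f g : L1 ω) (v : S) :
    Summable fun p : S × S => (if p.1 * p.2 = v then 1 else 0 : ℂ) * (f p.1 * g p.2) := by
  refine Summable.of_norm_bounded ((summable_prod' f g).mul_left (ω v)⁻¹) fun p => ?_
  rw [norm_mul]
  calc _ ≤ (ω v)⁻¹ * ω (p.1 * p.2) * ‖f p.1 * g p.2‖ :=
        mul_le_mul_of_nonneg_right (norm_ite_le ω v _) (norm_nonneg _)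
    _ = _ := by ring

open Classical in
theorem summable_triple (f g h : L1 ω) (v : S) :
    Summable fun q : S × (S × S) =>
      (if q.1 * (q.2.1 * q.2.2) = v then 1 else 0 : ℂ) * (f q.1 * (g q.2.1 * h q.2.2)) := by
  have hs : Summable fun q : S × (S × S) =>
      (‖f q.1‖ * ω q.1) * (‖g q.2.1 * h q.2.2‖ * ω (q.2.1 * q.2.2)) :=
    f.summable.mul_of_nonneg (summable_prod' g h) f.term_nonneg
      (fun _ => mul_nonneg (norm_nonneg _) (ω.pos _).le)
  refine Summable.of_norm_bounded (hs.mul_left (ω v)⁻¹) fun q => ?_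
  rw [norm_mul, norm_mul (f q.1)]
  have h1 := norm_ite_le ω v (q.1 * (q.2.1 * q.2.2))
  have h2 := mul_le_mul_of_nonneg_left (ω.mul_le q.1 (q.2.1 * q.2.2)) (inv_nonneg.2 (ω.pos v).le)
  calc _ ≤ (ω v)⁻¹ * (ω q.1 * ω (q.2.1 * q.2.2)) * (‖f q.1‖ * ‖g q.2.1 * h q.2.2‖) :=
        mul_le_mul_of_nonneg_right (h1.trans h2) (by positivity)
    _ = _ := by ring

open Classical in
theorem mul_assoc_apply_right (f g h : L1 ω) (v : S) :
    (f * (g * h)) v = ∑' q : S × (S × S),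
      (if q.1 * (q.2.1 * q.2.2) = v then 1 else 0 : ℂ) * (f q.1 * (g q.2.1 * h q.2.2)) := by
  rw [mul_apply_eq_ite, (summable_ite f (g * h) v).tsum_prod, (summable_triple f g h v).tsum_prod]
  refine tsum_congr fun s => ?_
  have hφ : ∀ u, ‖(if s * u = v then 1 else 0 : ℂ)‖ ≤ ((ω v)⁻¹ * ω s) * ω u := fun u =>
    (norm_ite_le ω v (s * u)).trans (by
      rw [mul_assoc]
      exact mul_le_mul_of_nonneg_left (ω.mul_le s u) (inv_nonneg.2 (ω.pos v).le))
  have := tsum_mul_conv g h (fun u => if s * u = v then 1 else 0) _ hφ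
  calc _ = f s * ∑' u, (if s * u = v then 1 else 0) * (g * h) u := by
        rw [← tsum_mul_left]; exact tsum_congr fun u => by ring
    _ = _ := by rw [this, ← tsum_mul_left]; exact tsum_congr fun u => by ring

open Classical in
theorem mul_assoc_apply_left (f g h : L1 ω) (v : S) :
    ((f * g) * h) v = ∑' q : S × (S × S),
      (if q.1 * (q.2.1 * q.2.2) = v then 1 else 0 : ℂ) * (f q.1 * (g q.2.1 * h q.2.2)) := by
  have ht : Summable fun q : S × (S × S) =>
      (if (q.2.1 * q.2.2) * q.1 = v then 1 else 0 : ℂ) * ((f q.2.1 * g q.2.2) * h q.1) := by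
    have := ((Equiv.prodComm S (S × S)).trans (Equiv.prodAssoc S S S)).summable_iff.2
      (summable_triple f g h v)
    refine this.congr fun q => ?_
    simp [mul_assoc]
  have hR : ∑' q : S × (S × S),
      (if q.1 * (q.2.1 * q.2.2) = v then 1 else 0 : ℂ) * (f q.1 * (g q.2.1 * h q.2.2)) =
      ∑' q : S × (S × S),
      (if (q.2.1 * q.2.2) * q.1 = v then 1 else 0 : ℂ) * ((f q.2.1 * g q.2.2) * h q.1) := by
    rw [← ((Equiv.prodComm S (S × S)).trans (Equiv.prodAssoc S S S)).tsum_eq]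
    refine tsum_congr fun q => ?_
    simp [mul_assoc]
  have hsw := (Equiv.prodComm S S).summable_iff.2 (summable_ite (f * g) h v)
  rw [hR, ht.tsum_prod, mul_apply_eq_ite, ← (Equiv.prodComm S S).tsum_eq]
  refine Eq.trans hsw.tsum_prod ?_
  refine tsum_congr fun s => ?_
  have hφ : ∀ u, ‖(if u * s = v then 1 else 0 : ℂ)‖ ≤ ((ω v)⁻¹ * ω s) * ω u := fun u =>
    (norm_ite_le ω v (u * s)).trans (by
      rw [mul_assoc, mul_comm (ω s)]
      exact mul_le_mul_of_nonneg_left (ω.mul_le u s) (inv_nonneg.2 (ω.pos v).le))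
  have := tsum_mul_conv f g (fun u => if u * s = v then 1 else 0) _ hφ
  calc _ = h s * ∑' u, (if u * s = v then 1 else 0) * (f * g) u := by
        rw [← tsum_mul_left]; exact tsum_congr fun u => by
          by_cases hu : u * s = v <;> simp [hu, mul_comm]
    _ = _ := by rw [this, ← tsum_mul_left]; exact tsum_congr fun u => by ring

instance : NonUnitalRing (L1 ω) :=
  { (inferInstance : AddCommGroup (L1 ω)), (inferInstance : Mul (L1 ω)) with
    left_distrib := fun f g h => by
      ext u
      simp only [mul_apply, add_apply, mul_add]
      exact (summable_fiber f g u).of_norm.tsum_add (summable_fiber f h u).of_norm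
    right_distrib := fun f g h => by
      ext u
      simp only [mul_apply, add_apply, add_mul]
      exact (summable_fiber f h u).of_norm.tsum_add (summable_fiber g h u).of_norm
    zero_mul := fun f => by ext u; simp [mul_apply]
    mul_zero := fun f => by ext u; simp [mul_apply]
    mul_assoc := fun f g h => by
      ext u
      rw [mul_assoc_apply_left, mul_assoc_apply_right] }

instance : NonUnitalNormedRing (L1 ω) :=
  { (inferInstance : NormedAddCommGroup (L1 ω)), (inferInstance : NonUnitalRing (L1 ω)) with
    norm_mul_le := norm_mul_le' }

instance : IsScalarTower ℂ (L1 ω) (L1 ω) := ⟨fun c f g => by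
  ext u
  simp only [smul_eq_mul, mul_apply, smul_apply, ← tsum_mul_left, mul_assoc]⟩

instance : SMulCommClass ℂ (L1 ω) (L1 ω) := ⟨fun c f g => by
  ext u
  simp only [smul_eq_mul, mul_apply, smul_apply, ← tsum_mul_left]
  exact tsum_congr fun p => by ring⟩

end L1

end L1

end ArensReg

end

/-!
Regularity passes from a Banach algebra `A` to a Banach algebra `B` as soon as there is a bounded
homomorphism `P : A → B` with a bounded linear right inverse `J`: the bitranspose `P**` is
multiplicative for both Arens products, and it is onto since `P** ∘ J** = id`
(`IsArensRegular.of_rightInverse`).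

For weights `ω` on `S` and `ω'` on `T` with `ω' ∘ ψ ≤ ω`, summation over the fibres of `ψ` is such
a homomorphism `P : ℓ₁(S, ω) → ℓ₁(T, ω')` (`L1.mapDomainCLM`, `L1.mapDomain_mul`). A section `σ` of
`ψ` with `ω ∘ σ ≤ C ω'` gives the right inverse `J`, which moves the mass at `t` to `σ t`
(`L1.extendCLM`). For `ω' = inf ω(ψ⁻¹(·))` such a section exists with `C = 2`, because this infimum
is positive; for `ω = ω' ∘ ψ` every section works with `C = 1`.

For the cluster property, lift two sequences in `T` along the same section `σ`. The quotient `Ω'`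
of the infimum weight satisfies `Ω'(t, u) ≤ 4 Ω(σ t, σ u)`, and by compactness of `[0, 1]^ℕ` the
lifted sequences have subsequences along which both iterated limits of `Ω` exist
(`exists_subseq_iterated_limits`). These vanish, hence so do those of `Ω'`.
-/

open Filter Topology

namespace ArensReg

/-! ### Arens regularity and bounded homomorphisms with a right inverse -/

theorem IsArensRegular.of_rightInverse {A B : Type*}
    [NonUnitalNormedRing A] [NormedSpace ℂ A] [IsScalarTower ℂ A A] [SMulCommClass ℂ A A]
    [NonUnitalNormedRing B] [NormedSpace ℂ B] [IsScalarTower ℂ B B] [SMulCommClass ℂ B B]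
    (P : A →L[ℂ] B) (hP : ∀ a b, P (a * b) = P a * P b) (J : B →L[ℂ] A)
    (hJ : ∀ b, P (J b) = b) (hA : IsArensRegular A) : IsArensRegular B := by
  intro Φ Ψ
  -- the transposes of `P` and `J`
  let Pt : StrongDual ℂ B →L[ℂ] StrongDual ℂ A := (ContinuousLinearMap.compL ℂ A B ℂ).flip P
  let Jt : StrongDual ℂ A →L[ℂ] StrongDual ℂ B := (ContinuousLinearMap.compL ℂ B A ℂ).flip J
  have hJP : ∀ f, Jt (Pt f) = f := fun f => by
    ext b
    exact congrArg f (hJ b)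
  ext f
  have h := congrArg (fun Θ : StrongDual ℂ (StrongDual ℂ A) => Θ (Pt f))
    (hA (Φ.comp Jt) (Ψ.comp Jt))
  -- `Pt` intertwines the actions of `A**` on `A*` with those of `B**` on `B*`
  have h1 : arensAdjoint (arensAdjoint (ContinuousLinearMap.mul ℂ A)) (Ψ.comp Jt) (Pt f) =
      Pt (arensAdjoint (arensAdjoint (ContinuousLinearMap.mul ℂ B)) Ψ f) := by
    ext a
    have : arensAdjoint (ContinuousLinearMap.mul ℂ A) (Pt f) a =
        Pt (arensAdjoint (ContinuousLinearMap.mul ℂ B) f (P a)) := by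
      ext c
      exact congrArg f (hP a c)
    change Ψ (Jt (arensAdjoint (ContinuousLinearMap.mul ℂ A) (Pt f) a)) =
      Ψ (arensAdjoint (ContinuousLinearMap.mul ℂ B) f (P a))
    rw [this, hJP]
  have h2 : arensAdjoint (arensAdjoint (ContinuousLinearMap.mul ℂ A).flip) (Φ.comp Jt) (Pt f) =
      Pt (arensAdjoint (arensAdjoint (ContinuousLinearMap.mul ℂ B).flip) Φ f) := by
    ext a
    have : arensAdjoint (ContinuousLinearMap.mul ℂ A).flip (Pt f) a =
        Pt (arensAdjoint (ContinuousLinearMap.mul ℂ B).flip f (P a)) := by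
      ext c
      exact congrArg f (hP c a)
    change Φ (Jt (arensAdjoint (ContinuousLinearMap.mul ℂ A).flip (Pt f) a)) =
      Φ (arensAdjoint (ContinuousLinearMap.mul ℂ B).flip f (P a))
    rw [this, hJP]
  change Φ (Jt (arensAdjoint (arensAdjoint (ContinuousLinearMap.mul ℂ A)) (Ψ.comp Jt) (Pt f))) =
    Ψ (Jt (arensAdjoint (arensAdjoint (ContinuousLinearMap.mul ℂ A).flip) (Φ.comp Jt) (Pt f))) at h
  rw [h1, h2, hJP, hJP] at h
  exact h

/-! ### Summation over the fibres of a homomorphism -/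

namespace L1

variable {S T : Type*} [Semigroup S] [Semigroup T] {ω : Weight S} {ω' : Weight T} {ψ : S →ₙ* T}

theorem summable_norm_mul_comp (h : ∀ s, ω' (ψ s) ≤ ω s) (f : L1 ω) :
    Summable fun s => ‖f s‖ * ω' (ψ s) :=
  Summable.of_nonneg_of_le (fun _ => mul_nonneg (norm_nonneg _) (ω'.pos _).le)
    (fun s => mul_le_mul_of_nonneg_left (h s) (norm_nonneg _)) f.summable

theorem summable_norm_mul_fibers (h : ∀ s, ω' (ψ s) ≤ ω s) (f : L1 ω) :
    Summable fun q : (Σ t : T, {s : S // ψ s = t}) => ‖f q.2.1‖ * ω' q.1 := by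
  refine ((Equiv.sigmaFiberEquiv ψ).summable_iff.2 (summable_norm_mul_comp h f)).congr ?_
  rintro ⟨t, s, rfl⟩
  rfl

theorem summable_norm_fiber (h : ∀ s, ω' (ψ s) ≤ ω s) (f : L1 ω) (t : T) :
    Summable fun s : {s : S // ψ s = t} => ‖f s.1‖ :=
  (summable_mul_right_iff (ω'.pos t).ne').1 ((summable_norm_mul_fibers h f).sigma_factor t)

theorem norm_tsum_fiber_mul_le (h : ∀ s, ω' (ψ s) ≤ ω s) (f : L1 ω) (t : T) :
    ‖∑' s : {s : S // ψ s = t}, f s.1‖ * ω' t ≤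
      ∑' s : {s : S // ψ s = t}, ‖f s.1‖ * ω' t := by
  rw [tsum_mul_right]
  exact mul_le_mul_of_nonneg_right (norm_tsum_le_tsum_norm (summable_norm_fiber h f t))
    (ω'.pos t).le

theorem summable_tsum_fiber (h : ∀ s, ω' (ψ s) ≤ ω s) (f : L1 ω) :
    Summable fun t => ‖∑' s : {s : S // ψ s = t}, f s.1‖ * ω' t :=
  Summable.of_nonneg_of_le (fun t => mul_nonneg (norm_nonneg _) (ω'.pos t).le)
    (norm_tsum_fiber_mul_le h f) (summable_norm_mul_fibers h f).sigma

/-- The map `ℓ₁(S, ω) → ℓ₁(T, ω')` that sends `f` to its sums `t ↦ ∑_{ψ(s) = t} f(s)` over the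
fibres of `ψ`, for weights with `ω' ∘ ψ ≤ ω`. -/
noncomputable def mapDomain (h : ∀ s, ω' (ψ s) ≤ ω s) (f : L1 ω) : L1 ω' :=
  mk (fun t => ∑' s : {s : S // ψ s = t}, f s.1) (summable_tsum_fiber h f)

theorem mapDomain_apply (h : ∀ s, ω' (ψ s) ≤ ω s) (f : L1 ω) (t : T) :
    mapDomain h f t = ∑' s : {s : S // ψ s = t}, f s.1 := rfl

theorem norm_mapDomain_le (h : ∀ s, ω' (ψ s) ≤ ω s) (f : L1 ω) : ‖mapDomain h f‖ ≤ ‖f‖ := by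
  have h1 : ‖mapDomain h f‖ ≤ ∑' t, ∑' s : {s : S // ψ s = t}, ‖f s.1‖ * ω' t :=
    (summable_tsum_fiber h f).tsum_le_tsum (norm_tsum_fiber_mul_le h f)
      (summable_norm_mul_fibers h f).sigma
  have h2 : ∑' t, ∑' s : {s : S // ψ s = t}, ‖f s.1‖ * ω' t = ∑' s, ‖f s‖ * ω' (ψ s) := by
    rw [← (summable_norm_mul_fibers h f).tsum_sigma, ← (Equiv.sigmaFiberEquiv ψ).tsum_eq]
    refine tsum_congr ?_
    rintro ⟨t, s, rfl⟩
    rfl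
  exact h1.trans (h2.le.trans ((summable_norm_mul_comp h f).tsum_le_tsum
    (fun s => mul_le_mul_of_nonneg_left (h s) (norm_nonneg _)) f.summable))

/-- `mapDomain` as a bounded linear map. -/
noncomputable def mapDomainCLM (h : ∀ s, ω' (ψ s) ≤ ω s) : L1 ω →L[ℂ] L1 ω' :=
  LinearMap.mkContinuous
    { toFun := mapDomain h
      map_add' := fun f g => by
        ext t
        exact (summable_norm_fiber h f t).of_norm.tsum_add (summable_norm_fiber h g t).of_norm
      map_smul' := fun c f => by
        ext t
        exact (summable_norm_fiber h f t).of_norm.tsum_mul_left c } 1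
    (fun f => by simpa using norm_mapDomain_le h f)

/-- Change of variables: `∑_t φ(t) (mapDomain f)(t) = ∑_s φ(ψ(s)) f(s)` when `φ / ω'` is bounded. -/
theorem tsum_mul_mapDomain (h : ∀ s, ω' (ψ s) ≤ ω s) (f : L1 ω) (φ : T → ℂ) (C : ℝ)
    (hφ : ∀ t, ‖φ t‖ ≤ C * ω' t) :
    ∑' t, φ t * mapDomain h f t = ∑' s, φ (ψ s) * f s := by
  have hs : Summable fun q : (Σ t : T, {s : S // ψ s = t}) => φ q.1 * f q.2.1 := by
    refine Summable.of_norm_bounded ((summable_norm_mul_fibers h f).mul_left C) fun q => ?_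
    rw [norm_mul]
    calc _ ≤ C * ω' q.1 * ‖f q.2.1‖ := mul_le_mul_of_nonneg_right (hφ _) (norm_nonneg _)
      _ = _ := by ring
  have h1 : ∑' q : (Σ t : T, {s : S // ψ s = t}), φ q.1 * f q.2.1 =
      ∑' t, φ t * mapDomain h f t := by
    rw [hs.tsum_sigma]
    exact tsum_congr fun t => (summable_norm_fiber h f t).of_norm.tsum_mul_left (φ t)
  rw [← h1, ← (Equiv.sigmaFiberEquiv ψ).tsum_eq]
  refine tsum_congr ?_
  rintro ⟨t, s, rfl⟩
  rfl

open Classical in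
/-- Both sides, evaluated at `v`, are the sum of `f(s) g(r)` over the pairs with
`ψ(s) ψ(r) = v`. -/
theorem mapDomain_mul (h : ∀ s, ω' (ψ s) ≤ ω s) (f g : L1 ω) :
    mapDomain h (f * g) = mapDomain h f * mapDomain h g := by
  ext v
  have hC : 0 ≤ (ω' v)⁻¹ := inv_nonneg.2 (ω'.pos v).le
  have hψ : ∀ s, ‖(if ψ s = v then 1 else 0 : ℂ)‖ ≤ (ω' v)⁻¹ * ω s := fun s =>
    (norm_ite_le ω' v (ψ s)).trans (mul_le_mul_of_nonneg_left (h s) hC)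
  have hφ : ∀ t u, ‖(if t * u = v then 1 else 0 : ℂ)‖ ≤ ((ω' v)⁻¹ * ω' t) * ω' u := fun t u =>
    (norm_ite_le ω' v (t * u)).trans (by
      rw [mul_assoc]
      exact mul_le_mul_of_nonneg_left (ω'.mul_le t u) hC)
  have hL : mapDomain h (f * g) v =
      ∑' p : S × S, (if ψ (p.1 * p.2) = v then 1 else 0 : ℂ) * (f p.1 * g p.2) := by
    rw [← tsum_mul_conv f g (fun u => if ψ u = v then 1 else 0) _ hψ,
      ← tsum_mul_mapDomain h (f * g) (fun u => if u = v then 1 else 0) _ (norm_ite_le ω' v),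
      tsum_eq_single v (fun u hu => by simp [hu])]
    simp
  have hs : Summable fun p : S × S =>
      (if ψ (p.1 * p.2) = v then 1 else 0 : ℂ) * (f p.1 * g p.2) := by
    refine Summable.of_norm_bounded ((summable_prod' f g).mul_left (ω' v)⁻¹) fun p => ?_
    rw [norm_mul]
    calc _ ≤ (ω' v)⁻¹ * ω (p.1 * p.2) * ‖f p.1 * g p.2‖ :=
          mul_le_mul_of_nonneg_right (hψ _) (norm_nonneg _)
      _ = _ := by ring
  -- the inner sum, as a function of `t`, is dominated by `ω'`
  have hb : ∀ t, ‖∑' u, (if t * u = v then 1 else 0 : ℂ) * mapDomain h g u‖ ≤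
      ((ω' v)⁻¹ * ‖mapDomain h g‖) * ω' t := fun t => by
    have := tsum_of_norm_bounded
      (f := fun u => (if t * u = v then 1 else 0 : ℂ) * mapDomain h g u)
      ((mapDomain h g).summable.hasSum.mul_left ((ω' v)⁻¹ * ω' t)) (fun u => by
        rw [norm_mul]
        calc _ ≤ ((ω' v)⁻¹ * ω' t) * ω' u * ‖mapDomain h g u‖ :=
              mul_le_mul_of_nonneg_right (hφ t u) (norm_nonneg _)
          _ = _ := by ring)
    rw [← norm_def] at this
    exact this.trans_eq (by ring)
  rw [hL, hs.tsum_prod, mul_apply_eq_ite, (summable_ite _ _ v).tsum_prod]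
  calc ∑' s, ∑' r, (if ψ (s * r) = v then 1 else 0 : ℂ) * (f s * g r)
      = ∑' s, (∑' u, (if ψ s * u = v then 1 else 0 : ℂ) * mapDomain h g u) * f s := by
        refine tsum_congr fun s => ?_
        rw [tsum_mul_mapDomain h g (fun u => if ψ s * u = v then 1 else 0) _ (hφ (ψ s)),
          ← tsum_mul_right]
        exact tsum_congr fun r => by rw [map_mul]; ring
    _ = ∑' t, (∑' u, (if t * u = v then 1 else 0 : ℂ) * mapDomain h g u) * mapDomain h f t :=
        (tsum_mul_mapDomain h f _ _ hb).symm
    _ = _ := by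
        refine tsum_congr fun t => ?_
        rw [← tsum_mul_right]
        exact tsum_congr fun u => by ring

/-! ### Transporting functions along a section -/

theorem summable_extend (σ : T → S) (hσ : Function.Injective σ) (C : ℝ)
    (hC : ∀ t, ω (σ t) ≤ C * ω' t) (g : L1 ω') :
    Summable fun s => ‖Function.extend σ g 0 s‖ * ω s := by
  refine (hσ.summable_iff fun s hs => ?_).1 ?_
  · rw [Function.extend_apply' _ _ _ (by simpa using hs)]
    simp
  · refine Summable.of_nonneg_of_le (fun t => mul_nonneg (norm_nonneg _) (ω.pos _).le)
      (fun t => ?_) (g.summable.mul_left C)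
    rw [Function.comp_apply, hσ.extend_apply]
    exact (mul_le_mul_of_nonneg_left (hC t) (norm_nonneg _)).trans_eq (by ring)

theorem norm_extend_le (σ : T → S) (hσ : Function.Injective σ) (C : ℝ)
    (hC : ∀ t, ω (σ t) ≤ C * ω' t) (g : L1 ω') :
    ‖(mk (Function.extend σ g 0) (summable_extend σ hσ C hC g) : L1 ω)‖ ≤ C * ‖g‖ := by
  have hs := summable_extend σ hσ C hC g
  rw [norm_def, norm_def, ← tsum_mul_left]
  simp only [mk_apply]
  rw [← hσ.tsum_eq (f := fun s => ‖Function.extend σ g 0 s‖ * ω s)]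
  · refine (hs.comp_injective hσ).tsum_le_tsum (fun t => ?_) (g.summable.mul_left C)
    rw [hσ.extend_apply]
    exact (mul_le_mul_of_nonneg_left (hC t) (norm_nonneg _)).trans_eq (by ring)
  · intro s hs
    by_contra h
    refine hs ?_
    simp only
    rw [Function.extend_apply' _ _ _ (by simpa using h)]
    simp

/-- The bounded linear map `ℓ₁(T, ω') → ℓ₁(S, ω)` that moves the value at `t` to `σ t` and is `0`
off the range of `σ`, for an injection `σ` with `ω ∘ σ ≤ C ω'`. -/
noncomputable def extendCLM (σ : T → S) (hσ : Function.Injective σ) (C : ℝ)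
    (hC : ∀ t, ω (σ t) ≤ C * ω' t) : L1 ω' →L[ℂ] L1 ω :=
  LinearMap.mkContinuous
    { toFun := fun g => mk (Function.extend σ g 0) (summable_extend σ hσ C hC g)
      map_add' := fun f g => by
        ext s
        by_cases hs : ∃ t, σ t = s
        · obtain ⟨t, rfl⟩ := hs
          simp [hσ.extend_apply]
        · simp [Function.extend_apply' _ _ _ hs]
      map_smul' := fun c f => by
        ext s
        by_cases hs : ∃ t, σ t = s
        · obtain ⟨t, rfl⟩ := hs
          simp [hσ.extend_apply]
        · simp [Function.extend_apply' _ _ _ hs] } C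
    (norm_extend_le σ hσ C hC)

theorem extendCLM_apply (σ : T → S) (hσ : Function.Injective σ) (C : ℝ)
    (hC : ∀ t, ω (σ t) ≤ C * ω' t) (g : L1 ω') (s : S) :
    extendCLM σ hσ C hC g s = Function.extend σ g 0 s := rfl

theorem mapDomain_extendCLM (h : ∀ s, ω' (ψ s) ≤ ω s) (σ : T → S) (hσψ : ∀ t, ψ (σ t) = t)
    (hσ : Function.Injective σ) (C : ℝ) (hC : ∀ t, ω (σ t) ≤ C * ω' t) (g : L1 ω') :
    mapDomain h (extendCLM σ hσ C hC g) = g := by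
  ext t
  rw [mapDomain_apply, tsum_eq_single ⟨σ t, hσψ t⟩]
  · rw [extendCLM_apply, hσ.extend_apply]
  · rintro ⟨s, hs⟩ hne
    rw [extendCLM_apply, Function.extend_apply']
    · rfl
    · rintro ⟨u, rfl⟩
      rw [hσψ] at hs
      subst hs
      exact hne rfl

theorem isArensRegular_of_section (h : ∀ s, ω' (ψ s) ≤ ω s) (σ : T → S)
    (hσψ : ∀ t, ψ (σ t) = t) (C : ℝ) (hC : ∀ t, ω (σ t) ≤ C * ω' t)
    (hS : IsArensRegular (L1 ω)) : IsArensRegular (L1 ω') :=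
  have hσ : Function.Injective σ := Function.LeftInverse.injective hσψ
  hS.of_rightInverse (mapDomainCLM h) (mapDomain_mul h) (extendCLM σ hσ C hC)
    (mapDomain_extendCLM h σ hσψ hσ C hC)

end L1

/-! ### The infimum weight -/

namespace Weight

variable {S T : Type*} [Semigroup S] [Semigroup T]

theorem Omega_nonneg (ω : Weight S) (s t : S) : 0 ≤ ω.Omega s t :=
  div_nonneg (ω.pos _).le (mul_pos (ω.pos _) (ω.pos _)).le

theorem Omega_le_one (ω : Weight S) (s t : S) : ω.Omega s t ≤ 1 :=
  div_le_one_of_le₀ (ω.mul_le s t) (mul_pos (ω.pos _) (ω.pos _)).le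

theorem push_map_le (ψ : S →ₙ* T) (hψ : Function.Surjective ψ) (ω : Weight S)
    (hω : ω.IsBoundedBelow) (s : S) : ω.push ψ hψ hω (ψ s) ≤ ω s :=
  csInf_le ⟨0, by rintro _ ⟨r, -, rfl⟩; exact (ω.pos r).le⟩ ⟨s, rfl, rfl⟩

theorem exists_section_le_two_mul_push (ψ : S →ₙ* T) (hψ : Function.Surjective ψ) (ω : Weight S)
    (hω : ω.IsBoundedBelow) :
    ∃ σ : T → S, (∀ t, ψ (σ t) = t) ∧ ∀ t, ω (σ t) ≤ 2 * ω.push ψ hψ hω t := by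
  have key : ∀ t, ∃ s, ψ s = t ∧ ω s ≤ 2 * ω.push ψ hψ hω t := fun t => by
    have hlt : sInf (ω '' (ψ ⁻¹' {t})) < 2 * ω.push ψ hψ hω t := by
      have := (ω.push ψ hψ hω).pos t
      change ω.push ψ hψ hω t < _
      linarith
    obtain ⟨r, hr⟩ := hψ t
    obtain ⟨_, ⟨s, hs, rfl⟩, hst⟩ := exists_lt_of_csInf_lt
      (⟨ω r, r, hr, rfl⟩ : (ω '' (ψ ⁻¹' {t})).Nonempty) hlt
    exact ⟨s, hs, hst.le⟩
  choose σ h1 h2 using key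
  exact ⟨σ, h1, h2⟩

theorem Omega_push_le (ψ : S →ₙ* T) (hψ : Function.Surjective ψ) (ω : Weight S)
    (hω : ω.IsBoundedBelow) (σ : T → S) (hσψ : ∀ t, ψ (σ t) = t)
    (hσ : ∀ t, ω (σ t) ≤ 2 * ω.push ψ hψ hω t) (t u : T) :
    (ω.push ψ hψ hω).Omega t u ≤ 4 * ω.Omega (σ t) (σ u) := by
  have h1 := ω.push_map_le ψ hψ hω (σ t * σ u)
  rw [map_mul, hσψ, hσψ] at h1
  have ht := (ω.push ψ hψ hω).pos t
  have hu := (ω.push ψ hψ hω).pos u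
  have h2 : ω (σ t) * ω (σ u) ≤ 4 * (ω.push ψ hψ hω t * ω.push ψ hψ hω u) :=
    (mul_le_mul (hσ t) (hσ u) (ω.pos _).le (by positivity)).trans_eq (by ring)
  have hσt := ω.pos (σ t)
  have hσu := ω.pos (σ u)
  unfold Omega
  rw [← mul_div_assoc, div_le_div_iff₀ (by positivity) (by positivity)]
  calc _ ≤ ω (σ t * σ u) * (4 * (ω.push ψ hψ hω t * ω.push ψ hψ hω u)) :=
        mul_le_mul h1 h2 (by positivity) (ω.pos _).le
    _ = _ := by ring

/-! ### Iterated limits and the 0-cluster property -/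

/-- A double sequence in `[0, 1]` has both iterated limits along suitable subsequences of its two
index sets. -/
theorem exists_subseq_iterated_limits (F : ℕ → ℕ → ℝ) (h0 : ∀ n m, 0 ≤ F n m)
    (h1 : ∀ n m, F n m ≤ 1) :
    ∃ θ φ : ℕ → ℕ, StrictMono θ ∧ StrictMono φ ∧ ∃ (f g : ℕ → ℝ) (a b : ℝ),
      (∀ n, Tendsto (fun m => F (θ n) (φ m)) atTop (𝓝 (f n))) ∧ Tendsto f atTop (𝓝 a) ∧
      (∀ m, Tendsto (fun n => F (θ n) (φ m)) atTop (𝓝 (g m))) ∧ Tendsto g atTop (𝓝 b) := by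
  have hK : IsCompact (Set.univ.pi fun _ : ℕ => Set.Icc (0 : ℝ) 1) :=
    isCompact_univ_pi fun _ => isCompact_Icc
  obtain ⟨p, hp, α, hα, hpα⟩ := hK.tendsto_subseq (x := fun m n => F n m)
    (fun m n _ => ⟨h0 n m, h1 n m⟩)
  obtain ⟨q, hq, β, hβ, hqβ⟩ := hK.tendsto_subseq (x := fun n m => F n m)
    (fun n m _ => ⟨h0 n m, h1 n m⟩)
  rw [tendsto_pi_nhds] at hpα hqβ
  obtain ⟨a, -, γ, hγ, haγ⟩ := isCompact_Icc.tendsto_subseq (x := fun n => p (β n))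
    (fun n => hp (β n) trivial)
  obtain ⟨b, -, δ, hδ, hbδ⟩ := isCompact_Icc.tendsto_subseq (x := fun m => q (α m))
    (fun m => hq (α m) trivial)
  exact ⟨β ∘ γ, α ∘ δ, hβ.comp hγ, hα.comp hδ, fun n => p (β (γ n)), fun m => q (α (δ m)), a, b,
    fun n => (hpα _).comp hδ.tendsto_atTop, haγ, fun m => (hqβ _).comp hγ.tendsto_atTop, hbδ⟩

theorem IsZeroCluster.push (ψ : S →ₙ* T) (hψ : Function.Surjective ψ) {ω : Weight S}
    (hω : ω.IsBoundedBelow) (h : ω.IsZeroCluster) : (ω.push ψ hψ hω).IsZeroCluster := by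
  intro x y hx hy f g a b hf ha hg hb
  obtain ⟨σ, hσψ, hσ⟩ := ω.exists_section_le_two_mul_push ψ hψ hω
  have hσi : Function.Injective σ := Function.LeftInverse.injective hσψ
  obtain ⟨θ, φ, hθ, hφ, f', g', a', b', hf', ha', hg', hb'⟩ := exists_subseq_iterated_limits
    (fun n m => ω.Omega (σ (x n)) (σ (y m))) (fun _ _ => ω.Omega_nonneg _ _)
    (fun _ _ => ω.Omega_le_one _ _)
  obtain ⟨rfl, rfl⟩ := h (fun n => σ (x (θ n))) (fun m => σ (y (φ m)))
    (hσi.comp (hx.comp hθ.injective)) (hσi.comp (hy.comp hφ.injective)) f' g' a' b' hf' ha' hg' hb'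
  have hle := ω.Omega_push_le ψ hψ hω σ hσψ hσ
  have hfle : ∀ n, f (θ n) ≤ 4 * f' n := fun n =>
    le_of_tendsto_of_tendsto' ((hf (θ n)).comp hφ.tendsto_atTop) ((hf' n).const_mul 4)
      fun m => hle _ _
  have hgle : ∀ m, g (φ m) ≤ 4 * g' m := fun m =>
    le_of_tendsto_of_tendsto' ((hg (φ m)).comp hθ.tendsto_atTop) ((hg' m).const_mul 4)
      fun n => hle _ _
  have hf0 : ∀ n, 0 ≤ f n := fun n => ge_of_tendsto' (hf n) fun m => Omega_nonneg _ _ _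
  have hg0 : ∀ m, 0 ≤ g m := fun m => ge_of_tendsto' (hg m) fun n => Omega_nonneg _ _ _
  constructor
  · refine le_antisymm ?_ (ge_of_tendsto' ha hf0)
    simpa using le_of_tendsto_of_tendsto' (ha.comp hθ.tendsto_atTop) (ha'.const_mul 4) hfle
  · refine le_antisymm ?_ (ge_of_tendsto' hb hg0)
    simpa using le_of_tendsto_of_tendsto' (hb.comp hφ.tendsto_atTop) (hb'.const_mul 4) hgle

end Weight

end ArensReg

open ArensReg in
theorem lemma2p2 {S T : Type*} [Semigroup S] [Semigroup T] (ψ : S →ₙ* T)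
    (hψ : Function.Surjective ψ) :
    (∀ (ω : Weight S) (hω : ω.IsBoundedBelow),
      (IsArensRegular (L1 ω) → IsArensRegular (L1 (ω.push ψ hψ hω))) ∧
      (ω.IsZeroCluster → (ω.push ψ hψ hω).IsZeroCluster)) ∧
    (∀ ω : Weight T, IsArensRegular (L1 (ω.comap ψ)) → IsArensRegular (L1 ω)) := by
  refine ⟨fun ω hω => ⟨fun h => ?_, Weight.IsZeroCluster.push ψ hψ hω⟩, fun ω h => ?_⟩
  · obtain ⟨σ, hσψ, hσ⟩ := ω.exists_section_le_two_mul_push ψ hψ hω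
    exact L1.isArensRegular_of_section (ω.push_map_le ψ hψ hω) σ hσψ 2 hσ h
  · refine L1.isArensRegular_of_section (ψ := ψ) (fun s => le_rfl) (Function.surjInv hψ)
      (Function.surjInv_eq hψ) 1 (fun t => ?_) h
    change ω (ψ (Function.surjInv hψ t)) ≤ 1 * ω t
    rw [Function.surjInv_eq hψ, one_mul]
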